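/- Fix an integer $\mathfrak m\ge 2$. For a finite set $A$ of vertices of a (simple, undirected, loopless) graph put $\delta(A)=\mathfrak m\,|A|-|R(A)|$, where $R(A)$ is the set of edges with both endpoints in $A$. A finite set $A$ of vertices of a graph $N$ is called self-sufficient in $N$, written $A\leqslant N$, if $\delta(A')\ge\delta(A)$ for every finite $A'$ with $A\subseteq A'\subseteq N$. Let $\mathsf K_0$ be the class of finite graphs all of whose induced subgraphs $A'$ satisfy $\delta(A')\ge 0$. Let $\mathbf M$ be the $(\mathsf K_0,\leqslant)$-generic structure, i.e. a countable graph such that: $\mathbf M$ is the union of a chain of finite sets self-sufficient in $\mathbf M$; every isomorphism between finite self-sufficient subsets of $\mathbf M$ extends to an automorphism of $\mathbf M$; and every member of $\mathsf K_0$ is isomorphic to a self-sufficient finite subset of $\mathbf M$. For a finite $A\subseteq\mathbf M$ let $\mathrm{cl}(A)$ be the smallest finite self-sufficient subset of $\mathbf M$ containing $A$, and let $\dim(A)=\delta(\mathrm{cl}(A))$. For $X\subseteq\mathbf M$ let $\mathrm{gcl}(X)$ be the set of all $x\in\mathbf M$ such that $\dim(A\cup\{x\})-\dim(A)=0$ for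 some finite $A\subseteq X$. Then there exists a countable subset $B\subseteq\mathbf M$ such that: 1. $\mathrm{gcl}(B)=\mathbf M$; 2. $B_0\leqslant\mathbf M$ for every finite $B_0\subseteq B$; 3. every permutation of $B$ extends to an automorphism of $\mathbf M$. -/

import Mathlib

namespace AbInitio

/-- The set of edges of the graph `M` with both endpoints in `A`. -/
def edgesIn {V : Type*} (M : SimpleGraph V) (A : Finset V) : Set (Sym2 V) :=
  {e | e ∈ M.edgeSet ∧ ∀ v ∈ e, v ∈ A}

/-- The predimension `δ(A) = m |A| - |R(A)|` of a finite set `A` of vertices of `M`. -/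
noncomputable def delta (m : ℕ) {V : Type*} (M : SimpleGraph V) (A : Finset V) : ℤ :=
  (m : ℤ) * (A.card : ℤ) - ((edgesIn M A).ncard : ℤ)

/-- `A ≤ M`: the finite set `A` is self-sufficient (closed) in the (finite or infinite) graph `M`,
that is, `δ(A') ≥ δ(A)` for every finite `A'` with `A ⊆ A' ⊆ M`. -/
def SelfSufficient (m : ℕ) {V : Type*} (M : SimpleGraph V) (A : Finset V) : Prop :=
  ∀ A' : Finset V, A ⊆ A' → delta m M A ≤ delta m M A'

/-- Membership in the class `K₀` of the finite graphs all of whose (induced) subgraphs have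
nonnegative predimension. -/
def InK0 (m : ℕ) {W : Type*} [Finite W] (H : SimpleGraph W) : Prop :=
  ∀ A : Finset W, 0 ≤ delta m H A

/-- The graph `M` is a `(K₀, ≤)`-generic structure (countability of the vertex set included). -/
structure IsGeneric (m : ℕ) {V : Type*} (M : SimpleGraph V) : Prop where
  countable : Countable V
  /-- `M` is the union of a chain of finite closed sets. -/
  chain : ∃ C : ℕ → Finset V, Monotone C ∧ (∀ i, SelfSufficient m M (C i)) ∧
    ∀ v : V, ∃ i, v ∈ C i
  /-- Every isomorphism between finite closed sets extends to an automorphism of `M`. -/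
  homogeneous : ∀ A B : Finset V, SelfSufficient m M A → SelfSufficient m M B →
    ∀ f : M.induce (A : Set V) ≃g M.induce (B : Set V),
      ∃ g : M ≃g M, ∀ a : (A : Set V), g (a : V) = (f a : V)
  /-- Every member of `K₀` (up to isomorphism, a graph on some `Fin n`) is isomorphic to a closed
  subset of `M`. With `n = 0` this says that the empty set is closed in `M`, so all finite subsets
  of `M` belong to `K₀`. -/
  universal : ∀ (n : ℕ) (H : SimpleGraph (Fin n)), InK0 m H →
    ∃ A : Finset V, SelfSufficient m M A ∧ Nonempty (H ≃g M.induce (A : Set V))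

/-- `C` is the smallest finite closed subset of `M` containing `A`. -/
def IsClosureOf (m : ℕ) {V : Type*} (M : SimpleGraph V) (A C : Finset V) : Prop :=
  IsLeast {D : Finset V | A ⊆ D ∧ SelfSufficient m M D} C

open Classical in
/-- The closure `cl(A)`: the smallest finite closed subset of `M` containing `A`. It exists in
every generic structure, see `isClosureOf_cl`; the value `A` otherwise is a dummy. -/
noncomputable def cl (m : ℕ) {V : Type*} (M : SimpleGraph V) (A : Finset V) : Finset V :=
  if h : ∃ C, IsClosureOf m M A C then h.choose else A

/-- The dimension `dim(A) = δ(cl(A))`. -/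
noncomputable def dim (m : ℕ) {V : Type*} (M : SimpleGraph V) (A : Finset V) : ℤ :=
  delta m M (cl m M A)

open Classical in
/-- The relative dimension `dim(x / A) = dim(xA) - dim(A)` of an element over a finite set. -/
noncomputable def relDim (m : ℕ) {V : Type*} (M : SimpleGraph V) (x : V) (A : Finset V) : ℤ :=
  dim m M (insert x A) - dim m M A

/-- The geometric closure `gcl(X)`. -/
def gcl (m : ℕ) {V : Type*} (M : SimpleGraph V) (X : Set V) : Set V :=
  {x | ∃ A : Finset V, (A : Set V) ⊆ X ∧ relDim m M x A = 0}

theorem edgesIn_finite {V : Type*} (M : SimpleGraph V) (A : Finset V) :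
    (edgesIn M A).Finite := by
  refine A.sym2.finite_toSet.subset fun e he => ?_
  exact Finset.mem_coe.2 (Finset.mem_sym2_iff.2 he.2)

open Classical in
theorem delta_union_add_inter (m : ℕ) {V : Type*} (M : SimpleGraph V) (A B : Finset V) :
    delta m M (A ∪ B) + delta m M (A ∩ B) ≤ delta m M A + delta m M B := by
  have h1 : (edgesIn M A ∪ edgesIn M B).ncard + (edgesIn M A ∩ edgesIn M B).ncard
      = (edgesIn M A).ncard + (edgesIn M B).ncard :=
    Set.ncard_union_add_ncard_inter _ _ (edgesIn_finite M A) (edgesIn_finite M B)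
  have h2 : edgesIn M A ∩ edgesIn M B = edgesIn M (A ∩ B) := by
    ext e
    simp only [edgesIn, Set.mem_inter_iff, Set.mem_setOf_eq, Finset.mem_inter]
    grind
  have h3 : (edgesIn M A ∪ edgesIn M B).ncard ≤ (edgesIn M (A ∪ B)).ncard := by
    refine Set.ncard_le_ncard ?_ (edgesIn_finite M _)
    rintro e (he | he)
    · exact ⟨he.1, fun v hv => Finset.mem_union_left _ (he.2 v hv)⟩
    · exact ⟨he.1, fun v hv => Finset.mem_union_right _ (he.2 v hv)⟩
  have h4 := Finset.card_union_add_card_inter A B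
  rw [h2] at h1
  have h5 : (m : ℤ) * (((A ∪ B).card : ℤ) + ((A ∩ B).card : ℤ))
      = (m : ℤ) * ((A.card : ℤ) + (B.card : ℤ)) := by
    congr 1
    exact_mod_cast h4
  unfold delta
  zify at h1 h3
  linarith

open Classical in
theorem SelfSufficient.inter {m : ℕ} {V : Type*} {M : SimpleGraph V} {A B : Finset V}
    (hA : SelfSufficient m M A) (hB : SelfSufficient m M B) : SelfSufficient m M (A ∩ B) := by
  intro X hX
  have e1 : B ∩ (A ∩ X) = A ∩ B := by
    ext v
    have := @hX v
    simp only [Finset.mem_inter] at *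
    tauto
  have h1 := delta_union_add_inter m M A X
  have h2 := hA (A ∪ X) Finset.subset_union_left
  have h3 := delta_union_add_inter m M B (A ∩ X)
  have h4 := hB (B ∪ (A ∩ X)) Finset.subset_union_left
  rw [e1] at h3
  linarith

/-- In a generic structure `cl` really is the smallest finite closed set containing `A`. -/
theorem isClosureOf_cl {m : ℕ} {V : Type*} {M : SimpleGraph V} (hM : IsGeneric m M)
    (A : Finset V) : IsClosureOf m M A (cl m M A) := by
  classical
  obtain ⟨C, hmono, hC, hcov⟩ := hM.chain
  have hne : ∃ D : Finset V, A ⊆ D ∧ SelfSufficient m M D := by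
    choose i hi using hcov
    exact ⟨C (A.sup i), fun v hv => hmono (Finset.le_sup hv) (hi v), hC _⟩
  obtain ⟨D, hD, hmin⟩ :=
    WellFounded.has_min (measure Finset.card).wf
      {D : Finset V | A ⊆ D ∧ SelfSufficient m M D} hne
  have hex : ∃ E, IsClosureOf m M A E := by
    refine ⟨D, hD, fun E hE => ?_⟩
    have h := hmin (D ∩ E) ⟨Finset.subset_inter hD.1 hE.1, hD.2.inter hE.2⟩
    have hle : D.card ≤ (D ∩ E).card := not_lt.1 h
    have := Finset.eq_of_subset_of_card_le Finset.inter_subset_left hle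
    exact Finset.inter_eq_left.1 this
  rw [cl, dif_pos hex]
  exact hex.choose_spec

end AbInitio

namespace AbInitio

section

open scoped Classical

variable {V W : Type*} {m : ℕ} {M : SimpleGraph V} {H : SimpleGraph W}

/-! The set `B` is built so that each finite subset is self-sufficient and edgeless (`FreeSet`), and
each vertex lies in a finite `C` with `δ(C) = m |C ∩ B|` (`Tight`). Then `δ(C) = δ(C ∩ B)`, so `C`
has dimension zero over `C ∩ B`, and `gcl(B)` is everything.

To build `B`, keep a free set inside a finite set and measure the deficit `δ - m |B|`. Genericity
supplies a new vertex joined to one chosen vertex only. Putting it in both sets raises `δ` by `m -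
1` and `m |B|` by `m`, so the deficit drops by one; a suitable choice of neighbour keeps `B` free
(`exists_free_of_delta_eq`).

Permutations extend because tight sets are self-sufficient, closed under union, and not adjacent to
the points of `B` outside them. A tight set and a finite part of `B` thus form a free amalgam, on
which an automorphism and the permutation glue together (`exists_extend_tight`). Back-and-forth
finishes. -/

/-! ### Predimension calculus and self-sufficient sets. -/

theorem edgesIn_insert [DecidableEq V] (M : SimpleGraph V) {A : Finset V} {b : V} :
    edgesIn M (insert b A) = edgesIn M A ∪ (fun v => s(b, v)) '' {v | v ∈ A ∧ M.Adj b v} := by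
  ext e
  induction e with
  | _ x y =>
    have hs := M.adj_comm x y
    have hx := M.irrefl (v := b)
    simp only [edgesIn, Set.mem_ofPred_eq, Set.mem_union, Set.mem_image, SimpleGraph.mem_edgeSet,
      Sym2.mem_iff, Finset.mem_insert, forall_eq_or_imp, forall_eq, Sym2.eq_iff]
    constructor
    · rintro ⟨hadj, rfl | hxA, rfl | hyA⟩
      · exact absurd hadj hx
      · exact Or.inr ⟨y, ⟨hyA, hadj⟩, Or.inl ⟨rfl, rfl⟩⟩
      · exact Or.inr ⟨x, ⟨hxA, hadj.symm⟩, Or.inr ⟨rfl, rfl⟩⟩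
      · exact Or.inl ⟨hadj, hxA, hyA⟩
    · rintro (⟨hadj, hxA, hyA⟩ | ⟨v, ⟨hv, hadj⟩, ⟨rfl, rfl⟩ | ⟨rfl, rfl⟩⟩)
      · exact ⟨hadj, Or.inr hxA, Or.inr hyA⟩
      · exact ⟨hadj, Or.inl rfl, Or.inr hv⟩
      · exact ⟨hadj.symm, Or.inr hv, Or.inl rfl⟩

theorem delta_insert [DecidableEq V] (m : ℕ) (M : SimpleGraph V) {A : Finset V} {b : V} (hb : b ∉ A) :
    delta m M (insert b A) = delta m M A + m - ((A.filter (M.Adj b)).card : ℤ) := by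
  have hinj : Function.Injective (fun v => s(b, v)) := fun v w h =>
    Sym2.congr_right.1 h
  have h1 : ((fun v => s(b, v)) '' {v | v ∈ A ∧ M.Adj b v}).ncard
      = (A.filter (M.Adj b)).card := by
    rw [Set.ncard_image_of_injective _ hinj, ← Set.ncard_coe_finset, Finset.coe_filter]
  have hdisj : Disjoint (edgesIn M A) ((fun v => s(b, v)) '' {v | v ∈ A ∧ M.Adj b v}) := by
    rw [Set.disjoint_left]
    rintro _ he ⟨v, -, rfl⟩
    exact hb (he.2 b (by simp))
  have hfin : ((fun v => s(b, v)) '' {v | v ∈ A ∧ M.Adj b v}).Finite :=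
    ((A.finite_toSet.subset fun v hv => hv.1)).image _
  have h2 := Set.ncard_union_eq hdisj (edgesIn_finite M A) hfin
  rw [← edgesIn_insert, h1] at h2
  unfold delta
  rw [h2, Finset.card_insert_of_notMem hb]
  push_cast
  ring

theorem delta_empty (m : ℕ) (M : SimpleGraph V) : delta m M ∅ = 0 := by
  have : edgesIn M (∅ : Finset V) = ∅ := by
    refine Set.eq_empty_of_forall_notMem fun e he => ?_
    induction e with
    | _ x y => exact absurd (he.2 x (by simp)) (by simp)
  simp [delta, this]

theorem delta_map (m : ℕ) (f : H ↪g M) (S : Finset W) :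
    delta m M (S.map f.toEmbedding) = delta m H S := by
  induction S using Finset.induction_on with
  | empty => simp [delta_empty]
  | insert b S hb ih =>
    have hb' : f.toEmbedding b ∉ S.map f.toEmbedding := by simpa using hb
    rw [Finset.map_insert, delta_insert m M hb', delta_insert m H hb, ih, Finset.filter_map,
      Finset.card_map]
    congr 3
    ext x
    simp

/-- Submodularity. It reduces tests of self-sufficiency for subsets of `A` to sets inside `A`. -/
theorem SelfSufficient.delta_inter_le {A : Finset V} (hA : SelfSufficient m M A) (Y : Finset V) :
    delta m M (A ∩ Y) ≤ delta m M Y := by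
  have h1 := delta_union_add_inter m M A Y
  have h2 := hA (A ∪ Y) Finset.subset_union_left
  linarith

theorem SelfSufficient.of_delta_le {A B : Finset V} (hB : SelfSufficient m M B) (h : B ⊆ A)
    (hd : delta m M A ≤ delta m M B) : SelfSufficient m M A :=
  fun Y hY => hd.trans (hB Y (h.trans hY))

theorem SelfSufficient.map {A : Finset V} (hA : SelfSufficient m M A) (g : M ≃g M) :
    SelfSufficient m M (A.map g.toEmbedding.toEmbedding) := by
  intro Y hY
  rw [delta_map, ← delta_map m g.symm.toEmbedding Y]
  refine hA _ fun a ha => ?_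
  rw [Finset.mem_map]
  exact ⟨g a, hY (Finset.mem_map_of_mem _ ha), g.symm_apply_apply a⟩

/-- It suffices to test inside `insert b A`, where the only competitor is `insert b A` itself, and
`b` contributes `m` minus at most `m` edges. -/
theorem SelfSufficient.of_insert {A : Finset V} {b : V} (hb : b ∉ A)
    (h : SelfSufficient m M (insert b A)) (hc : (A.filter (M.Adj b)).card ≤ m) :
    SelfSufficient m M A := by
  intro Y hY
  refine le_trans ?_ (h.delta_inter_le Y)
  by_cases hbY : b ∈ Y
  · have : insert b A ∩ Y = insert b A :=
      Finset.inter_eq_left.2 (Finset.insert_subset hbY hY)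
    rw [this, delta_insert m M hb]
    have : ((A.filter (M.Adj b)).card : ℤ) ≤ m := by exact_mod_cast hc
    linarith
  · rw [Finset.insert_inter_of_notMem hbY, Finset.inter_eq_left.2 hY]

theorem IsGeneric.selfSufficient_empty (hM : IsGeneric m M) : SelfSufficient m M ∅ := by
  obtain ⟨A, hA, ⟨e⟩⟩ := hM.universal 0 ⊥ fun A => by
    rw [Finset.eq_empty_of_isEmpty A, delta_empty]
  have : A = ∅ := by
    refine Finset.eq_empty_of_forall_notMem fun a ha => ?_
    exact (e.symm ⟨a, ha⟩).elim0
  exact this ▸ hA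

theorem IsGeneric.delta_nonneg (hM : IsGeneric m M) (A : Finset V) : 0 ≤ delta m M A := by
  have := hM.selfSufficient_empty A (Finset.empty_subset A)
  rwa [delta_empty] at this

theorem IsGeneric.exists_extend (hM : IsGeneric m M) {A : Finset V} (hA : SelfSufficient m M A)
    (φ : V → V) (hinj : Set.InjOn φ A) (hadj : ∀ x ∈ A, ∀ y ∈ A, M.Adj (φ x) (φ y) ↔ M.Adj x y)
    (himg : SelfSufficient m M (A.image φ)) : ∃ g : M ≃g M, ∀ a ∈ A, g a = φ a := by
  have hbij : Set.BijOn φ (A : Set V) (A.image φ : Finset V) := by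
    rw [Finset.coe_image]
    exact hinj.bijOn_image
  let e : M.induce (A : Set V) ≃g M.induce ((A.image φ : Finset V) : Set V) :=
    { toEquiv := hbij.equiv φ
      map_rel_iff' := fun {a b} => hadj a a.2 b b.2 }
  obtain ⟨g, hg⟩ := hM.homogeneous _ _ hA himg e
  exact ⟨g, fun a ha => hg ⟨a, ha⟩⟩

/-! ### Adjoining a leaf to a self-sufficient set. -/

/-- The graph `H` with one new vertex `none`, joined to `c` only. -/
def addLeaf (H : SimpleGraph W) (c : W) : SimpleGraph (Option W) where
  Adj
    | some u, some v => H.Adj u v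
    | some u, none => u = c
    | none, some u => u = c
    | none, none => False
  symm := by
    constructor
    rintro (_ | u) (_ | v) h
    exacts [h, h, h, SimpleGraph.Adj.symm (G := H) h]
  loopless := by
    constructor
    rintro (_ | u) h
    exacts [h, H.irrefl h]

/-- The inclusion of `H` into `addLeaf H c`. -/
def someAddLeaf (H : SimpleGraph W) (c : W) : H ↪g addLeaf H c where
  toEmbedding := Function.Embedding.some
  map_rel_iff' := Iff.rfl

theorem inK0_addLeaf [Finite W] (hm : 1 ≤ m) {c : W} (h : InK0 m H) : InK0 m (addLeaf H c) := by
  have key : ∀ T : Finset (Option W), none ∉ T → 0 ≤ delta m (addLeaf H c) T := by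
    intro T hT
    have : T = (Finset.eraseNone T).map (someAddLeaf H c).toEmbedding := by
      change T = (Finset.eraseNone T).map Function.Embedding.some
      rw [Finset.map_some_eraseNone, Finset.erase_eq_of_notMem hT]
    rw [this, delta_map]
    exact h _
  intro S
  by_cases hS : none ∈ S
  · rw [← Finset.insert_erase hS, delta_insert m _ (Finset.notMem_erase _ _)]
    have h1 : ((S.erase none).filter ((addLeaf H c).Adj none)).card ≤ 1 := by
      rw [Finset.card_le_one]
      rintro (_ | u) hu (_ | v) hv
      · rfl
      · exact ((Finset.mem_filter.1 hu).2).elim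
      · exact ((Finset.mem_filter.1 hv).2).elim
      · have hu' : u = c := (Finset.mem_filter.1 hu).2
        have hv' : v = c := (Finset.mem_filter.1 hv).2
        rw [hu', hv']
    have h2 := key _ (Finset.notMem_erase none S)
    omega
  · exact key S hS

/-- Universality gives a self-sufficient copy of `C` with a leaf. Deleting the leaf leaves a
self-sufficient copy of `C`, which homogeneity moves back onto `C`. -/
theorem IsGeneric.exists_leaf (hM : IsGeneric m M) (hm : 1 ≤ m) {C : Finset V}
    (hC : SelfSufficient m M C) {c : V} (hc : c ∈ C) :
    ∃ b, b ∉ C ∧ SelfSufficient m M (insert b C) ∧ ∀ v ∈ C, M.Adj b v ↔ v = c := by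
  let H : SimpleGraph (C : Set V) := M.induce (C : Set V)
  let c' : (C : Set V) := ⟨c, hc⟩
  let L := addLeaf H c'
  have hH : InK0 m H := fun A => by
    rw [← delta_map m (SimpleGraph.Embedding.induce (C : Set V)) A]
    exact hM.delta_nonneg _
  have hL : InK0 m L := inK0_addLeaf hm hH
  let i := L.overFinIso rfl
  obtain ⟨D, hD, ⟨e⟩⟩ := hM.universal _ (L.overFin rfl) fun A => by
    rw [← delta_map m i.symm.toEmbedding A]
    exact hL _
  let j : L ≃g M.induce (D : Set V) := i.trans e
  let F : L ↪g M := (SimpleGraph.Embedding.induce (D : Set V)).comp j.toEmbedding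
  -- The value outside `C` is a dummy.
  let φ : V → V := fun u => if h : u ∈ C then F (some ⟨u, h⟩) else u
  have hφ : ∀ u (h : u ∈ C), φ u = F (some ⟨u, h⟩) := fun u h => dif_pos h
  have hDeq : D = insert (F none) (C.image φ) := by
    ext d
    rw [Finset.mem_insert, Finset.mem_image]
    constructor
    · intro hd
      have hj : F (j.symm ⟨d, hd⟩) = d :=
        congrArg Subtype.val (j.apply_symm_apply (⟨d, hd⟩ : (D : Set V)))
      rcases h : j.symm ⟨d, hd⟩ with _ | u
      · left; rw [← h, hj]
      · right; exact ⟨u, u.2, by rw [hφ u u.2, ← hj, h]⟩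
    · rintro (rfl | ⟨u, hu, rfl⟩)
      · exact (j none).2
      · rw [hφ u hu]; exact (j _).2
  have hnone : F none ∉ C.image φ := by
    rw [Finset.mem_image]
    rintro ⟨u, hu, h⟩
    rw [hφ u hu] at h
    exact absurd (F.injective h) (by simp)
  have hadj : ∀ u (hu : u ∈ C), M.Adj (F none) (φ u) ↔ u = c := fun u hu => by
    rw [hφ u hu, F.map_adj_iff]
    change (⟨u, hu⟩ : (C : Set V)) = c' ↔ _
    exact Subtype.ext_iff
  have himg : SelfSufficient m M (C.image φ) := by
    refine SelfSufficient.of_insert hnone (hDeq ▸ hD) (le_trans ?_ hm)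
    rw [Finset.card_le_one]
    simp only [Finset.mem_filter, Finset.mem_image]
    rintro _ ⟨⟨u, hu, rfl⟩, h⟩ _ ⟨⟨v, hv, rfl⟩, h'⟩
    rw [(hadj u hu).1 h, (hadj v hv).1 h']
  obtain ⟨g, hg⟩ := hM.exists_extend hC φ
    (fun u hu v hv h => by
      rw [hφ u hu, hφ v hv] at h
      simpa using F.injective h)
    (fun u hu v hv => by
      rw [hφ u hu, hφ v hv, F.map_adj_iff]
      rfl) himg
  refine ⟨g.symm (F none), fun h => hnone ?_, ?_, fun v hv => ?_⟩
  · rw [Finset.mem_image]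
    exact ⟨_, h, by rw [← hg _ h, g.apply_symm_apply]⟩
  · convert hD.map g.symm using 1
    rw [hDeq, Finset.map_insert]
    congr 1
    ext v
    simp only [Finset.mem_map, Finset.mem_image]
    constructor
    · intro hv
      exact ⟨φ v, ⟨v, hv, rfl⟩, by rw [← hg v hv]; exact g.symm_apply_apply v⟩
    · rintro ⟨_, ⟨u, hu, rfl⟩, rfl⟩
      rw [← hg u hu]
      convert hu
      exact g.symm_apply_apply u
  · rw [← hadj v hv, ← hg v hv, ← g.map_adj_iff, g.apply_symm_apply]

/-! ### Free sets and the reduction of the deficit. -/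

/-- A finite set is free if it is self-sufficient and spans no edges. -/
def Free (m : ℕ) (M : SimpleGraph V) (S : Finset V) : Prop :=
  SelfSufficient m M S ∧ delta m M S = m * S.card

theorem Free.mono {S T : Finset V} (hT : Free m M T) (h : S ⊆ T) : Free m M S := by
  have hedge : edgesIn M T = ∅ := by
    have h1 := hT.2
    unfold delta at h1
    have h2 : (edgesIn M T).ncard = 0 := by omega
    exact (Set.ncard_eq_zero (edgesIn_finite M T)).1 h2
  have key : ∀ X ⊆ T, delta m M X = m * X.card := by
    intro X hX
    have : edgesIn M X = ∅ := Set.eq_empty_of_subset_empty fun e he =>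
      hedge ▸ (⟨he.1, fun v hv => hX (he.2 v hv)⟩ : e ∈ edgesIn M T)
    simp [delta, this]
  refine ⟨fun Y hY => ?_, key S h⟩
  refine le_trans ?_ (hT.1.delta_inter_le Y)
  rw [key S h, key _ Finset.inter_subset_left]
  have := Finset.card_le_card (Finset.subset_inter h hY)
  gcongr

/-- Induction on the deficit `r` of `C`. The auxiliary set `A`, of deficit zero, is carried along
because the new vertex must be attached outside it. -/
theorem exists_free_of_delta_eq (hM : IsGeneric m M) (hm : 1 ≤ m) (r : ℕ) :
    ∀ B A C : Finset V, Free m M B → B ⊆ A → delta m M A = m * B.card → A ⊆ C →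
      SelfSufficient m M C → delta m M C = m * B.card + r →
      ∃ B' C' : Finset V, B ⊆ B' ∧ C ⊆ C' ∧ Free m M B' ∧ B' ⊆ C' ∧
        delta m M C' = m * B'.card := by
  induction r with
  | zero =>
    intro B A C hB hBA hA hAC hC hr
    exact ⟨B, C, subset_rfl, subset_rfl, hB, hBA.trans hAC, by simpa using hr⟩
  | succ r ih =>
    intro B A C hB hBA hA hAC hC hr
    have hAcl : SelfSufficient m M A := hB.1.of_delta_le hBA (by rw [hA, hB.2])
    -- Take `c` outside a largest `X` between `A` and `C` with `δ(X) ≤ δ(A)`. By submodularity any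
    -- other such set has its union with `X` of the same kind, so it lies in `X` and misses `c`.
    obtain ⟨c, hcC, hc⟩ : ∃ c ∈ C, ∀ X : Finset V, A ⊆ X → X ⊆ C → c ∈ X →
        delta m M A < delta m M X := by
      obtain ⟨X, hX, hmax⟩ := Finset.exists_max_image
        (C.powerset.filter fun X => A ⊆ X ∧ delta m M X ≤ delta m M A) Finset.card
        ⟨A, by simp [hAC]⟩
      simp only [Finset.mem_filter, Finset.mem_powerset] at hX hmax
      obtain ⟨hXC, hAX, hXA⟩ := hX
      have hne : ∃ c ∈ C, c ∉ X := by
        by_contra! hcon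
        have : X = C := hXC.antisymm hcon
        rw [this] at hXA
        push_cast at hr
        omega
      obtain ⟨c, hcC, hcX⟩ := hne
      refine ⟨c, hcC, fun Y hAY hYC hcY => lt_of_not_ge fun hY => ?_⟩
      have h1 := delta_union_add_inter m M X Y
      have h2 := hAcl (X ∩ Y) (Finset.subset_inter hAX hAY)
      have h3 := hmax (X ∪ Y) ⟨Finset.union_subset hXC hYC,
        hAX.trans Finset.subset_union_left, by linarith⟩
      have h4 := Finset.eq_of_subset_of_card_le Finset.subset_union_left h3
      exact hcX (h4 ▸ Finset.mem_union_right _ hcY)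
    have hcA : c ∉ A := fun h => lt_irrefl _ (hc A subset_rfl hAC h)
    obtain ⟨b, hbC, hbcl, hb⟩ := hM.exists_leaf hm hC hcC
    have hdel : ∀ Z ⊆ C, delta m M (insert b Z)
        = delta m M Z + m - (if c ∈ Z then 1 else 0) := by
      intro Z hZ
      rw [delta_insert m M fun h => hbC (hZ h)]
      congr 1
      split_ifs with h
      · have : Z.filter (M.Adj b) = {c} := by
          ext v
          rw [Finset.mem_filter, Finset.mem_singleton]
          exact ⟨fun hv => (hb v (hZ hv.1)).1 hv.2, fun hv => hv ▸ ⟨h, (hb c hcC).2 rfl⟩⟩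
        simp [this]
      · have : Z.filter (M.Adj b) = ∅ :=
          Finset.filter_eq_empty_iff.2 fun v hv hadj => h ((hb v (hZ hv)).1 hadj ▸ hv)
        simp [this]
    have hcB : c ∉ B := fun h => hcA (hBA h)
    have hA' : delta m M (insert b A) = delta m M A + m := by rw [hdel A hAC, if_neg hcA]; simp
    -- A competitor containing `c` loses one for the edge to `b`, but by the choice of `c` its trace
    -- on `C` exceeds `δ(A)` by at least one.
    have hA'cl : SelfSufficient m M (insert b A) := by
      intro Y hY
      refine le_trans ?_ (hbcl.delta_inter_le Y)
      have hbY := hY (Finset.mem_insert_self b A)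
      rw [Finset.insert_inter_of_mem hbY, hA', hdel _ Finset.inter_subset_left]
      have hAZ : A ⊆ C ∩ Y :=
        Finset.subset_inter hAC ((Finset.subset_insert b A).trans hY)
      split_ifs with h
      · have := hc _ hAZ Finset.inter_subset_left h
        linarith
      · have := hAcl _ hAZ
        linarith
    have hbB : b ∉ B := fun h => hbC (hAC (hBA h))
    have hB' : delta m M (insert b B) = m * (insert b B).card := by
      rw [hdel B (hBA.trans hAC), if_neg hcB, hB.2, Finset.card_insert_of_notMem hbB]
      push_cast; ring
    -- Inside `insert b A` the vertex `b` is isolated, since `c ∉ A`.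
    have hB'cl : SelfSufficient m M (insert b B) := by
      intro Y hY
      refine le_trans ?_ (hA'cl.delta_inter_le Y)
      have hbY := hY (Finset.mem_insert_self b B)
      rw [Finset.insert_inter_of_mem hbY, hdel _ (Finset.inter_subset_left.trans hAC),
        hdel B (hBA.trans hAC), if_neg hcB, if_neg fun h => hcA (Finset.mem_inter.1 h).1]
      have := hB.1 (A ∩ Y) (Finset.subset_inter hBA ((Finset.subset_insert b B).trans hY))
      linarith
    obtain ⟨B', C', h1, h2, h3⟩ := ih (insert b B) (insert b A) (insert b C) ⟨hB'cl, hB'⟩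
      (Finset.insert_subset_insert b hBA)
      (by rw [hA', hA, Finset.card_insert_of_notMem hbB]; push_cast; ring)
      (Finset.insert_subset_insert b hAC) hbcl
      (by
        rw [hdel C subset_rfl, if_pos hcC, hr, Finset.card_insert_of_notMem hbB]
        push_cast; ring)
    exact ⟨B', C', (Finset.subset_insert b B).trans h1, (Finset.subset_insert b C).trans h2, h3⟩

/-- A step-by-step construction meeting countably many requirements. -/
theorem exists_seq_of_step {S : Type*} [Countable V] [Nonempty V] (R : S → S → Prop)
    (hrefl : ∀ s, R s s) (htrans : ∀ s t u, R s t → R t u → R s u) (P : V → S → Prop)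
    (hstep : ∀ s v, ∃ t, R s t ∧ P v t) (s₀ : S) :
    ∃ s : ℕ → S, (∀ i j, i ≤ j → R (s i) (s j)) ∧ ∀ v, ∃ n, P v (s n) := by
  obtain ⟨e, he⟩ := exists_surjective_nat V
  choose t ht using hstep
  let s : ℕ → S := fun n => Nat.rec s₀ (fun k a => t a (e k)) n
  refine ⟨s, fun i j hij => ?_, fun v => ?_⟩
  · induction hij with
    | refl => exact hrefl _
    | step _ ih => exact htrans _ _ _ ih (ht _ _).1
  · obtain ⟨k, rfl⟩ := he v
    exact ⟨k + 1, (ht _ _).2⟩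

/-! ### Tight sets over a free set. -/

/-- A finite set `A` is tight over `B` if its predimension equals that of its trace on the free
set `B`. -/
def Tight (m : ℕ) (M : SimpleGraph V) (B : Set V) (A : Finset V) : Prop :=
  delta m M A = m * (A.filter (· ∈ B)).card

/-- Every finite subset of `B` is free. -/
def FreeSet (m : ℕ) (M : SimpleGraph V) (B : Set V) : Prop :=
  ∀ S : Finset V, (S : Set V) ⊆ B → Free m M S

variable {B : Set V}

theorem coe_filter_subset (A : Finset V) : ((A.filter (· ∈ B) : Finset V) : Set V) ⊆ B :=
  fun _ hx => (Finset.mem_filter.1 hx).2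

theorem FreeSet.card_filter_le_delta (hB : FreeSet m M B) (A : Finset V) :
    (m : ℤ) * (A.filter (· ∈ B)).card ≤ delta m M A := by
  have h := hB _ (coe_filter_subset A)
  rw [← h.2]
  exact h.1 A (Finset.filter_subset _ _)

theorem FreeSet.tight (hB : FreeSet m M B) {S : Finset V} (hS : (S : Set V) ⊆ B) :
    Tight m M B S := by
  rw [Tight, Finset.filter_true_of_mem fun x hx => hS hx]
  exact (hB S hS).2

theorem Tight.selfSufficient {A : Finset V} (hA : Tight m M B A) (hB : FreeSet m M B) :
    SelfSufficient m M A := by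
  have h := hB _ (coe_filter_subset A)
  exact h.1.of_delta_le (Finset.filter_subset _ _) (by rw [h.2]; exact hA.le)

/-- Submodularity gives the upper bound, once the intersection is bounded below by its trace on `B`;
traces count modularly. -/
theorem Tight.union {A A' : Finset V} (hA : Tight m M B A) (hA' : Tight m M B A')
    (hB : FreeSet m M B) : Tight m M B (A ∪ A') := by
  refine le_antisymm ?_ (hB.card_filter_le_delta _)
  have h1 := delta_union_add_inter m M A A'
  have h2 := hB.card_filter_le_delta (A ∩ A')
  have h3 := Finset.card_union_add_card_inter (A.filter (· ∈ B)) (A'.filter (· ∈ B))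
  rw [← Finset.filter_union, ← Finset.filter_inter_distrib] at h3
  have h4 : (m : ℤ) * ((((A ∪ A').filter (· ∈ B)).card : ℤ) + ((A ∩ A').filter (· ∈ B)).card)
      = m * (((A.filter (· ∈ B)).card : ℤ) + (A'.filter (· ∈ B)).card) := by
    congr 1
    exact_mod_cast h3
  rw [hA, hA'] at h1
  linarith

/-- Adding `b` raises the lower bound `m |A ∩ B|` by `m`, so `δ` must rise by the full `m`, leaving
no room for an edge. -/
theorem Tight.not_adj {A : Finset V} (hA : Tight m M B A) (hB : FreeSet m M B) {a b : V}
    (ha : a ∈ A) (hb : b ∈ B) (hbA : b ∉ A) : ¬ M.Adj b a := by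
  intro hadj
  have h1 := hB.card_filter_le_delta (insert b A)
  rw [Finset.filter_insert, if_pos hb, Finset.card_insert_of_notMem fun h =>
    hbA (Finset.mem_filter.1 h).1, delta_insert m M hbA, hA] at h1
  have h2 : 0 < (A.filter (M.Adj b)).card :=
    Finset.card_pos.2 ⟨a, Finset.mem_filter.2 ⟨ha, hadj⟩⟩
  push_cast at h1
  have h3 : (m : ℤ) * ((A.filter (· ∈ B)).card + 1) = m * (A.filter (· ∈ B)).card + m := by ring
  omega

theorem FreeSet.not_adj (hB : FreeSet m M B) {a b : V} (ha : a ∈ B) (hb : b ∈ B) :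
    ¬ M.Adj b a := by
  by_cases h : b = a
  · exact h ▸ M.irrefl
  · exact (hB.tight (S := {a}) (by simpa using ha)).not_adj hB (by simp) hb (by simpa using h)

/-- The automorphism `g` sends `A` to a tight set and `A ∩ B` into `B`. -/
theorem Tight.apply_mem_iff {A : Finset V} (hA : Tight m M B A) (hm : 1 ≤ m)
    (hB : FreeSet m M B) (g : M ≃g M) (hg : ∀ a ∈ A, a ∈ B → g a ∈ B) {a : V} (ha : a ∈ A) :
    g a ∈ B ↔ a ∈ B := by
  refine ⟨fun h => ?_, hg a ha⟩
  -- The image has predimension `m |A ∩ B|`, so at most `|A ∩ B|` points of `A` can land in `B`;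
  -- those of `A ∩ B` already do.
  have h1 := hB.card_filter_le_delta (A.map g.toEmbedding.toEmbedding)
  rw [delta_map, hA, Finset.filter_map, Finset.card_map] at h1
  have h2 : (A.filter ((· ∈ B) ∘ g.toEmbedding.toEmbedding)).card ≤ (A.filter (· ∈ B)).card := by
    have : (0 : ℤ) < m := by exact_mod_cast hm
    exact_mod_cast le_of_mul_le_mul_left h1 this
  have h3 : A.filter (· ∈ B) = A.filter ((· ∈ B) ∘ g.toEmbedding.toEmbedding) := by
    refine Finset.eq_of_subset_of_card_le (fun x hx => ?_) h2
    rw [Finset.mem_filter] at hx ⊢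
    exact ⟨hx.1, hg x hx.1 hx.2⟩
  exact (Finset.mem_filter.1 (h3 ▸ Finset.mem_filter.2 ⟨ha, h⟩ : a ∈ A.filter (· ∈ B))).2

theorem Tight.map {A : Finset V} (hA : Tight m M B A) (hm : 1 ≤ m)
    (hB : FreeSet m M B) (g : M ≃g M) (hg : ∀ a ∈ A, a ∈ B → g a ∈ B) :
    Tight m M B (A.map g.toEmbedding.toEmbedding) := by
  rw [Tight, delta_map, hA, Finset.filter_map, Finset.card_map]
  congr 3
  refine Finset.filter_congr fun x hx => ?_
  exact (hA.apply_mem_iff hm hB g hg hx).symm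

/-- Both `A ∪ C` and its image are tight, hence self-sufficient, and no edges meet the added points
of `B` on either side, so `g` on `A` and `σ` on `C` combine to an isomorphism that homogeneity
extends. -/
theorem exists_extend_tight (hM : IsGeneric m M) (hm : 1 ≤ m) (hB : FreeSet m M B)
    (σ : Equiv.Perm V) (hσ : ∀ x, σ x ∈ B ↔ x ∈ B) {A C : Finset V} (hA : Tight m M B A)
    (hC : (C : Set V) ⊆ B) (g : M ≃g M) (hg : ∀ a ∈ A, a ∈ B → g a = σ a) :
    ∃ g' : M ≃g M, (∀ a ∈ A, g' a = g a) ∧ ∀ c ∈ C, g' c = σ c := by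
  have hgB : ∀ a ∈ A, a ∈ B → g a ∈ B := fun a ha h => by rw [hg a ha h]; exact (hσ a).2 h
  have hiff : ∀ a ∈ A, (g a ∈ B ↔ a ∈ B) := fun a ha => hA.apply_mem_iff hm hB g hgB ha
  have hgA := hA.map hm hB g hgB
  let φ : V → V := fun x => if x ∈ B then σ x else g x
  have hφA : ∀ a ∈ A, φ a = g a := fun a ha => by
    by_cases h : a ∈ B
    · rw [hg a ha h]; exact if_pos h
    · exact if_neg h
  have hφB : ∀ b ∈ B, φ b = σ b := fun b hb => if_pos hb
  have himg : (A ∪ C).image φ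
      = A.map g.toEmbedding.toEmbedding ∪ C.map σ.toEmbedding := by
    rw [Finset.image_union, Finset.map_eq_image, Finset.map_eq_image]
    congr 1
    · exact Finset.image_congr fun a ha => hφA a ha
    · exact Finset.image_congr fun c hc => hφB c (hC hc)
  have himgT : Tight m M B ((A ∪ C).image φ) := by
    rw [himg]
    refine hgA.union (hB.tight fun x hx => ?_) hB
    obtain ⟨c, hc, rfl⟩ := Finset.mem_map.1 (Finset.mem_coe.1 hx)
    exact (hσ c).2 (hC hc)
  have hdom : ∀ x ∈ A ∪ C, x ∉ A → x ∈ B := fun x hx hxA =>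
    hC ((Finset.mem_union.1 hx).resolve_left hxA)
  have hnotin : ∀ y ∈ B, y ∉ A → φ y ∉ A.map g.toEmbedding.toEmbedding := by
    intro y hy hyA h
    obtain ⟨z, hz, hzy⟩ := Finset.mem_map.1 h
    change g z = φ y at hzy
    rw [hφB y hy] at hzy
    have hzB : z ∈ B := (hiff z hz).1 (by rw [hzy]; exact (hσ y).2 hy)
    rw [hg z hz hzB] at hzy
    exact hyA (σ.injective hzy ▸ hz)
  have hmapA : ∀ x ∈ A, φ x ∈ A.map g.toEmbedding.toEmbedding := fun x hx => by
    rw [hφA x hx]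
    exact Finset.mem_map_of_mem g.toEmbedding.toEmbedding hx
  have hφmem : ∀ y ∈ B, φ y ∈ B := fun y hy => by rw [hφB y hy]; exact (hσ y).2 hy
  obtain ⟨g', hg'⟩ := hM.exists_extend ((hA.union (hB.tight hC) hB).selfSufficient hB) φ
    (by
      intro x hx y hy hxy
      by_cases hxA : x ∈ A
      · by_cases hyA : y ∈ A
        · rw [hφA x hxA, hφA y hyA] at hxy
          exact g.injective hxy
        · exact absurd (hxy ▸ hmapA x hxA) (hnotin y (hdom y hy hyA) hyA)
      · have hxB := hdom x hx hxA
        by_cases hyA : y ∈ A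
        · exact absurd (hxy ▸ hmapA y hyA) (hnotin x hxB hxA)
        · rw [hφB x hxB, hφB y (hdom y hy hyA)] at hxy
          exact σ.injective hxy)
    (by
      have hmix : ∀ x ∈ A, ∀ y ∈ B, y ∉ A → (M.Adj (φ y) (φ x) ↔ M.Adj y x) :=
        fun x hx y hy hyA => iff_of_false
          (hgA.not_adj hB (hmapA x hx) (hφmem y hy) (hnotin y hy hyA)) (hA.not_adj hB hx hy hyA)
      intro x hx y hy
      by_cases hxA : x ∈ A
      · by_cases hyA : y ∈ A
        · rw [hφA x hxA, hφA y hyA, g.map_adj_iff]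
        · rw [M.adj_comm, M.adj_comm x]
          exact hmix x hxA y (hdom y hy hyA) hyA
      · have hxB := hdom x hx hxA
        by_cases hyA : y ∈ A
        · exact hmix y hyA x hxB hxA
        · have hyB := hdom y hy hyA
          exact iff_of_false (hB.not_adj (hφmem y hyB) (hφmem x hxB)) (hB.not_adj hyB hxB))
    (himgT.selfSufficient hB)
  exact ⟨g', fun a ha => (hg' a (Finset.mem_union_left _ ha)).trans (hφA a ha),
    fun c hc => (hg' c (Finset.mem_union_right _ hc)).trans (hφB c (hC hc))⟩

/-! ### Back-and-forth along a permutation. -/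

/-- A tight set together with an automorphism that agrees with `σ` on its trace on `B`. -/
structure PartialExt (m : ℕ) (M : SimpleGraph V) (B : Set V) (σ : Equiv.Perm V) where
  carrier : Finset V
  aut : M ≃g M
  tight : Tight m M B carrier
  agree : ∀ a ∈ carrier, a ∈ B → aut a = σ a

variable {σ : Equiv.Perm V}

/-- The order of extension on `PartialExt`. -/
def PartialExt.Le (p q : PartialExt m M B σ) : Prop :=
  p.carrier ⊆ q.carrier ∧ ∀ a ∈ p.carrier, q.aut a = p.aut a

theorem PartialExt.Le.trans {p q r : PartialExt m M B σ} (h : p.Le q) (h' : q.Le r) : p.Le r :=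
  ⟨h.1.trans h'.1, fun a ha => (h'.2 a (h.1 ha)).trans (h.2 a ha)⟩

/-- Only the values on `C ∩ B` need to be prescribed; the new automorphism may treat the rest of `C`
arbitrarily. -/
theorem PartialExt.exists_forth (hM : IsGeneric m M) (hm : 1 ≤ m) (hB : FreeSet m M B)
    (hσ : ∀ x, σ x ∈ B ↔ x ∈ B) (hcov : ∀ x, ∃ C, x ∈ C ∧ Tight m M B C)
    (p : PartialExt m M B σ) (x : V) :
    ∃ q : PartialExt m M B σ, p.Le q ∧ x ∈ q.carrier := by
  obtain ⟨C, hxC, hC⟩ := hcov x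
  obtain ⟨g', h1, h2⟩ := exists_extend_tight hM hm hB σ hσ p.tight (coe_filter_subset C) p.aut
    p.agree
  refine ⟨⟨p.carrier ∪ C, g', p.tight.union hC hB, fun a ha haB => ?_⟩,
    ⟨Finset.subset_union_left, h1⟩, Finset.mem_union_right _ hxC⟩
  rcases Finset.mem_union.1 ha with ha | ha
  · rw [h1 a ha, p.agree a ha haB]
  · exact h2 a (Finset.mem_filter.2 ⟨ha, haB⟩)

theorem PartialExt.exists_back (hM : IsGeneric m M) (hm : 1 ≤ m) (hB : FreeSet m M B)
    (hσ : ∀ x, σ x ∈ B ↔ x ∈ B) (hcov : ∀ x, ∃ C, x ∈ C ∧ Tight m M B C)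
    (p : PartialExt m M B σ) (y : V) :
    ∃ q : PartialExt m M B σ, p.Le q ∧ ∃ x ∈ q.carrier, q.aut x = y := by
  -- Inverting an extension of `τ` gives one of `τ⁻¹`. This is used for `σ` and, after a forth step,
  -- for `σ⁻¹`.
  have inv : ∀ (τ : Equiv.Perm V) (_ : ∀ x, τ x ∈ B ↔ x ∈ B) (r : PartialExt m M B τ),
      Tight m M B (r.carrier.map r.aut.toEmbedding.toEmbedding) ∧
      ∀ a ∈ r.carrier.map r.aut.toEmbedding.toEmbedding, a ∈ B → r.aut.symm a = τ.symm a := by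
    intro τ hτ r
    have hr : ∀ a ∈ r.carrier, a ∈ B → r.aut a ∈ B := fun a ha h => by
      rw [r.agree a ha h]; exact (hτ a).2 h
    refine ⟨r.tight.map hm hB r.aut hr, fun a ha haB => ?_⟩
    obtain ⟨z, hz, rfl⟩ := Finset.mem_map.1 ha
    change r.aut z ∈ B at haB
    change r.aut.symm (r.aut z) = τ.symm (r.aut z)
    have hzB := (r.tight.apply_mem_iff hm hB r.aut hr hz).1 haB
    rw [r.agree z hz hzB, τ.symm_apply_apply, ← r.agree z hz hzB, r.aut.symm_apply_apply]
  have hσ' : ∀ x, σ.symm x ∈ B ↔ x ∈ B := fun x => by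
    rw [← hσ (σ.symm x), σ.apply_symm_apply]
  let p' : PartialExt m M B σ.symm := ⟨_, p.aut.symm, (inv σ hσ p).1, (inv σ hσ p).2⟩
  obtain ⟨q', hq', hy⟩ := p'.exists_forth hM hm hB hσ' hcov y
  let q : PartialExt m M B σ := ⟨_, q'.aut.symm, (inv _ hσ' q').1, (inv _ hσ' q').2⟩
  have hpq : ∀ a ∈ p.carrier, q'.aut (p.aut a) = a := fun a ha => by
    rw [hq'.2 (p.aut a) (Finset.mem_map_of_mem _ ha)]
    exact p.aut.symm_apply_apply a
  refine ⟨q, ⟨fun a ha => ?_, fun a ha => ?_⟩, q'.aut y, Finset.mem_map_of_mem _ hy,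
    q'.aut.symm_apply_apply y⟩
  · exact Finset.mem_map.2 ⟨p.aut a, hq'.1 (Finset.mem_map_of_mem _ ha), hpq a ha⟩
  · change q'.aut.symm a = p.aut a
    rw [← hpq a ha, q'.aut.symm_apply_apply, hpq a ha]

theorem exists_aut_extending_perm (hM : IsGeneric m M) (hm : 1 ≤ m) (hB : FreeSet m M B)
    (hσ : ∀ x, σ x ∈ B ↔ x ∈ B) (hcov : ∀ x, ∃ C, x ∈ C ∧ Tight m M B C) :
    ∃ g : M ≃g M, ∀ b ∈ B, g b = σ b := by
  have := hM.countable
  rcases isEmpty_or_nonempty V with hV | hV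
  · exact ⟨SimpleGraph.Iso.refl, fun b => hV.elim b⟩
  obtain ⟨s, hs, hP⟩ := exists_seq_of_step (V := V) (S := PartialExt m M B σ) PartialExt.Le
    (fun p => ⟨subset_rfl, fun _ _ => rfl⟩) (fun _ _ _ => PartialExt.Le.trans)
    (fun v p => v ∈ p.carrier ∧ ∃ x ∈ p.carrier, p.aut x = v)
    (fun p v => by
      obtain ⟨q, hpq, hv⟩ := p.exists_forth hM hm hB hσ hcov v
      obtain ⟨r, hqr, hr⟩ := q.exists_back hM hm hB hσ hcov v
      exact ⟨r, hpq.trans hqr, hqr.1 hv, hr⟩)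
    ⟨∅, SimpleGraph.Iso.refl, by simp [Tight, delta_empty], by simp⟩
  choose n hn hsurj using hP
  -- The automorphisms stabilise at `v` once `v` enters the carrier.
  let F : V → V := fun v => (s (n v)).aut v
  have hF : ∀ v k, n v ≤ k → (s k).aut v = F v := fun v k h => (hs _ _ h).2 v (hn v)
  have hinj : Function.Injective F := fun x y hxy => by
    rw [← hF x _ (le_max_left (n x) (n y)), ← hF y _ (le_max_right (n x) (n y))] at hxy
    exact (s _).aut.injective hxy
  have hsur : Function.Surjective F := fun y => by
    obtain ⟨x, hx, hxy⟩ := hsurj y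
    refine ⟨x, ?_⟩
    rw [← hF x _ (le_max_left (n x) (n y)), (hs _ _ (le_max_right (n x) (n y))).2 x hx, hxy]
  refine ⟨{ toEquiv := Equiv.ofBijective F ⟨hinj, hsur⟩, map_rel_iff' := fun {x y} => ?_ },
    fun b hb => (s (n b)).agree b (hn b) hb⟩
  change M.Adj (F x) (F y) ↔ M.Adj x y
  rw [← hF x _ (le_max_left (n x) (n y)), ← hF y _ (le_max_right (n x) (n y)),
    SimpleGraph.Iso.map_adj_iff]

/-! ### Existence of the basis and its geometric closure. -/

theorem exists_freeSet_forall_tight (hM : IsGeneric m M) (hm : 1 ≤ m) :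
    ∃ B : Set V, FreeSet m M B ∧ ∀ x, ∃ C, x ∈ C ∧ Tight m M B C := by
  have := hM.countable
  rcases isEmpty_or_nonempty V with hV | hV
  · refine ⟨∅, fun S hS => ?_, fun x => hV.elim x⟩
    rw [Finset.eq_empty_of_isEmpty S]
    exact ⟨hM.selfSufficient_empty, by simp [delta_empty]⟩
  obtain ⟨s, hs, hP⟩ := exists_seq_of_step (V := V)
    (S := {p : Finset V × Finset V // Free m M p.1 ∧ p.1 ⊆ p.2 ∧ delta m M p.2 = m * p.1.card})
    (fun p q => p.1.1 ⊆ q.1.1 ∧ p.1.2 ⊆ q.1.2) (fun p => ⟨subset_rfl, subset_rfl⟩)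
    (fun p q r h h' => ⟨h.1.trans h'.1, h.2.trans h'.2⟩) (fun v p => v ∈ p.1.2)
    (by
      rintro ⟨⟨B, A⟩, hB, hBA, hA⟩ v
      obtain ⟨⟨hsub, hcl⟩, -⟩ := isClosureOf_cl hM (insert v A)
      have hAC : A ⊆ cl m M (insert v A) := (Finset.subset_insert v A).trans hsub
      -- The deficit of the closure is nonnegative because `B` is self-sufficient.
      have h0 : 0 ≤ delta m M (cl m M (insert v A)) - m * B.card := by
        have := hB.1 _ (hBA.trans hAC)
        rw [hB.2] at this
        linarith
      obtain ⟨r, hr⟩ := Int.eq_ofNat_of_zero_le h0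
      obtain ⟨B', C', h1, h2, h3⟩ := exists_free_of_delta_eq hM hm r B A _ hB hBA hA hAC hcl
        (by linarith)
      exact ⟨⟨(B', C'), h3⟩, ⟨h1, hAC.trans h2⟩, h2 (hsub (Finset.mem_insert_self v A))⟩)
    ⟨(∅, ∅), ⟨hM.selfSufficient_empty, by simp [delta_empty]⟩, subset_rfl,
      by simp [delta_empty]⟩
  have hfree : FreeSet m M (⋃ n, ((s n).1.1 : Set V)) := by
    intro S hS
    have hmem : ∀ v ∈ S, ∃ n, v ∈ (s n).1.1 := fun v hv => by
      simpa using Set.mem_iUnion.1 (hS hv)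
    choose! i hi using hmem
    refine (s (S.sup i)).2.1.mono fun v hv => ?_
    exact (hs _ _ (Finset.le_sup hv)).1 (hi v hv)
  refine ⟨_, hfree, fun x => ?_⟩
  obtain ⟨n, hn⟩ := hP x
  refine ⟨(s n).1.2, hn, le_antisymm ?_ (hfree.card_filter_le_delta _)⟩
  rw [(s n).2.2.2]
  have : (s n).1.1.card ≤ ((s n).1.2.filter (· ∈ ⋃ n, ((s n).1.1 : Set V))).card :=
    Finset.card_le_card fun v hv => Finset.mem_filter.2
      ⟨(s n).2.2.1 hv, Set.mem_iUnion.2 ⟨n, hv⟩⟩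
  gcongr

/-- With `S = C ∩ B`, which is its own closure, `δ(S) ≤ δ(cl(S ∪ {x})) ≤ δ(C) = δ(S)`. -/
theorem Tight.mem_gcl (hM : IsGeneric m M) (hB : FreeSet m M B) {C : Finset V}
    (hC : Tight m M B C) {x : V} (hx : x ∈ C) : x ∈ gcl m M B := by
  have hfree := hB _ (coe_filter_subset C)
  set S := C.filter (· ∈ B) with hS
  refine ⟨S, coe_filter_subset C, ?_⟩
  obtain ⟨⟨h1, h2⟩, h3⟩ := isClosureOf_cl hM S
  obtain ⟨⟨k1, k2⟩, k3⟩ := isClosureOf_cl hM (insert x S)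
  have e1 : cl m M S = S := (h3 ⟨subset_rfl, hfree.1⟩).antisymm h1
  have hSC : insert x S ⊆ C := Finset.insert_subset hx (Finset.filter_subset _ _)
  have e2 := k2 C (k3 ⟨hSC, hC.selfSufficient hB⟩)
  have e3 := hfree.1 _ ((Finset.subset_insert x S).trans k1)
  rw [hC, ← hfree.2] at e2
  rw [relDim, dim, dim, e1]
  convert sub_eq_zero.2 (le_antisymm e2 e3)

end

end AbInitio

theorem mainTheorem7 {V : Type*} (m : ℕ) (hm : 2 ≤ m) (M : SimpleGraph V)
    (hM : AbInitio.IsGeneric m M) :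
    ∃ B : Set V, B.Countable ∧
      AbInitio.gcl m M B = Set.univ ∧
      (∀ B₀ : Finset V, (B₀ : Set V) ⊆ B → AbInitio.SelfSufficient m M B₀) ∧
      ∀ γ : Equiv.Perm B, ∃ g : M ≃g M, ∀ b : B, g (b : V) = (γ b : V) := by
  classical
  have := hM.countable
  have hm' : 1 ≤ m := by omega
  obtain ⟨B, hB, hcov⟩ := AbInitio.exists_freeSet_forall_tight hM hm'
  refine ⟨B, B.to_countable, Set.eq_univ_of_forall fun x => ?_, fun S hS => (hB S hS).1,
    fun γ => ?_⟩
  · obtain ⟨C, hx, hC⟩ := hcov x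
    exact hC.mem_gcl hM hB hx
  · have hσ : ∀ x, Equiv.Perm.ofSubtype γ x ∈ B ↔ x ∈ B :=
      Equiv.Perm.ofSubtype_apply_mem_iff_mem γ
    obtain ⟨g, hg⟩ := AbInitio.exists_aut_extending_perm hM hm' hB hσ hcov
    exact ⟨g, fun b => by rw [hg b b.2, Equiv.Perm.ofSubtype_apply_coe]⟩
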